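/- Let $(R,\mathfrak m)$ be a Cohen--Macaulay local ring of dimension one possessing a canonical module $\omega_R$. Let $\mathrm Q(R)$ be the total ring of fractions of $R$ and let $\overline R$ be the integral closure of $R$ in $\mathrm Q(R)$. Suppose that: (a) there exists an $R$-submodule $C$ of $\mathrm Q(R)$ such that $R\subseteq C\subseteq\overline R$ and $C\cong\omega_R$; (b) $\overline R$ is finitely generated as an $R$-module; (c) $\overline R$ is a local ring; (d) there exists a non-zerodivisor $a\in\mathfrak m$ such that $(a)$ is a reduction of $\mathfrak m$, i.e. $a\,\mathfrak m^n=\mathfrak m^{n+1}$ for some $n\ge 0$. Let $\mathrm{tr}_R(\omega_R)=\sum_{f\in\mathrm{Hom}_R(\omega_R,R)} f(\omega_R)$ be the trace ideal of $\omega_R$, and let $R:\overline R=\{\alpha\in\mathrm Q(R)\mid \alpha\overline R\subseteq R\}$. If $R$ is a far-flung Gorenstein ring, that is, $\mathrm{tr}_R(\omega_R)=R:\overline R$, and the Cohen--Macaulay type $\mathrm r(R)=\dim_{R/\mathfrak m}\mathrm{Ext}^1_R(R/\mathfrak m,R)$ is equal to $2$, then $R$ has minimal multiplicity, i.e. its multiplicity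 $\mathrm e(R)$ equals $v(R)-\dim R+1=v(R)$, where $v(R)=\dim_{R/\mathfrak m}\mathfrak m/\mathfrak m^2$ is the embedding dimension. Moreover, under these hypotheses, $\mathrm e(R)=3$. -/

import Mathlib

universe u v

open IsLocalRing CategoryTheory Filter Topology

namespace FarFlung

noncomputable section

/-- A finitely generated module `M` over a Noetherian local ring `R` is maximal Cohen-Macaulay:
the maximal ideal contains an `M`-regular sequence of length `dim R`, i.e. `depth M = dim R`. -/
def IsMaximalCohenMacaulay (R : Type u) [CommRing R] [IsLocalRing R]
    (M : Type v) [AddCommGroup M] [Module R M] : Prop :=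
  Module.Finite R M ∧
    ∃ rs : List R, (∀ x ∈ rs, x ∈ maximalIdeal R) ∧
      RingTheory.Sequence.IsRegular M rs ∧ ringKrullDim R = rs.length

/-- A Cohen-Macaulay local ring: a Noetherian local ring with `depth R = dim R`. -/
def IsCohenMacaulayLocalRing (R : Type u) [CommRing R] [IsLocalRing R] : Prop :=
  IsNoetherianRing R ∧ IsMaximalCohenMacaulay R R

/-- The maximal Cohen-Macaulay module `M` over the local ring `R` with residue field `k` has
Cohen-Macaulay type `r`: `dim_k Ext^d(k, M) = r`, where `d = dim R = depth M`.
(The dimension is expressed as the length over `R`, because `Ext^d(k, M)` is killed by the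
maximal ideal.) -/
def HasType (R : Type u) [CommRing R] [IsLocalRing R]
    (M : Type u) [AddCommGroup M] [Module R M] (r : ℕ) : Prop :=
  ∃ d : ℕ, ringKrullDim R = d ∧
    Module.length R
      (Abelian.Ext (ModuleCat.of R (ResidueField R)) (ModuleCat.of R M) d) = r

/-- A canonical module of a Cohen-Macaulay local ring: a maximal Cohen-Macaulay module of type `1`
and of finite injective dimension. -/
structure IsCanonicalModule (R : Type u) [CommRing R] [IsLocalRing R]
    (ω : Type u) [AddCommGroup ω] [Module R ω] : Prop where
  maximalCohenMacaulay : IsMaximalCohenMacaulay R ω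
  type_one : HasType R ω 1
  finite_injectiveDimension : ∃ n : ℕ, HasInjectiveDimensionLE (ModuleCat.of R ω) n

/-- The trace ideal `tr_R(M)`: the sum of the images of all linear maps `M → R`, i.e. the image of
the evaluation map `Hom_R(M, R) ⊗ M → R`. -/
def traceIdeal (R : Type u) [CommRing R] (M : Type v) [AddCommGroup M] [Module R M] : Ideal R :=
  ⨆ f : M →ₗ[R] R, LinearMap.range f

/-- The integral closure of `R` in `K`, as an `R`-submodule of `K`. -/
abbrev integralClosureSubmodule (R : Type u) [CommRing R] (K : Type v) [CommRing K] [Algebra R K] :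
    Submodule R K :=
  Subalgebra.toSubmodule (integralClosure R K)

/-- The equality `tr_R(ω) = R : R̄` defining far-flung Gorenstein rings, where `K` is the total
ring of fractions of `R`, `R̄` is the integral closure of `R` in `K` and
`R : R̄ = {α ∈ K | α R̄ ⊆ R}`. (Here `1 : Submodule R K` is the image of `R` in `K`.) -/
def IsFarFlungGorenstein (R : Type u) [CommRing R] (K : Type v) [CommRing K] [Algebra R K]
    (ω : Type u) [AddCommGroup ω] [Module R ω] : Prop :=
  Submodule.map (Algebra.linearMap R K) (traceIdeal R ω) =
    (1 : Submodule R K) / integralClosureSubmodule R K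

/-- The ideal `J` is a reduction of the ideal `I`: `J ⊆ I` and `J I ^ n = I ^ (n + 1)` for
some `n`. -/
def IsReduction {R : Type u} [CommRing R] (J I : Ideal R) : Prop :=
  J ≤ I ∧ ∃ n : ℕ, J * I ^ n = I ^ (n + 1)

/-- The (Hilbert-Samuel) multiplicity of the Noetherian local ring `(R, m)` equals `e`:
`e = lim_n d! ℓ(R / m ^ n) / n ^ d`, where `d = dim R`. -/
def HasMultiplicity (R : Type u) [CommRing R] [IsLocalRing R] (e : ℕ) : Prop :=
  ∃ d : ℕ, ringKrullDim R = d ∧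
    Tendsto
      (fun n : ℕ =>
        (d.factorial : ℝ) * ((Module.length R (R ⧸ maximalIdeal R ^ n)).toNat : ℝ) / (n : ℝ) ^ d)
      atTop (𝓝 (e : ℝ))

/-- The embedding dimension `v(R) = dim_k (m / m ^ 2)`. -/
def embeddingDimension (R : Type u) [CommRing R] [IsLocalRing R] : ℕ :=
  Module.finrank (ResidueField R) (CotangentSpace R)

/-- A Cohen-Macaulay local ring has minimal multiplicity: `e(R) = v(R) - dim R + 1`. -/
def HasMinimalMultiplicity (R : Type u) [CommRing R] [IsLocalRing R] : Prop :=
  ∃ e d : ℕ, ringKrullDim R = d ∧ HasMultiplicity R e ∧ e + d = embeddingDimension R + 1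

end

end FarFlung

namespace FarFlung

open Abelian

/-! ### Vanishing of Ext along a submodule and its quotient. -/

section ExtVanishing

variable {R : Type u} [CommRing R]

/-! Write `A : B` for `A / B` inside `K`, and B for the integral closure of R. Canonical duality
says that `C : (C : I) = I` for every finitely generated `I ⊆ K` containing a nonzerodivisor of R;
in particular `C : C = R` (`div_div_eq_self`). Multiplication by an element of `R : C`, evaluated at
1, shows that `R : C` lies in the trace ideal, so the far-flung condition gives `R : C = R : B`.
Hence `C : C² = (C : C) : C = R : C = R : B = (C : C) : B = C : CB = C : B`, and duality yields `C²
= B` (`sq_eq_integralClosureSubmodule`).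

Type two makes C generated by two elements x, y, so B is generated by x², xy, y² and B/mB has length
at most 3. As (a) is a reduction of m, `mB ⊆ aB`; since also ℓ(R/a) = ℓ(B/aB), it follows that
ℓ(R/a) ≤ 3. The socle of R/a has length 2, which forces length exactly 3 and `m² ⊆ (a)`, then `m² =
am`. The Hilbert function is now explicit, ℓ(R/mⁿ⁺¹) = 3n + 1, and the multiplicity and the
embedding dimension are both 3.

Duality is extracted from the definition of ω: finite injective dimension kills Ext² from modules of
finite length, type one makes Ext¹(k, ω) nonzero, and together they imply that Ext¹(M, ω) = 0 only
for M = 0 among modules M of finite length. -/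

theorem shortExact_subtype_mkQ {M : Type u} [AddCommGroup M] [Module R M] (N : Submodule R M) :
    (ModuleCat.shortComplexOfCompEqZero N.subtype N.mkQ
      (LinearMap.exact_subtype_mkQ N).linearMap_comp_eq_zero).ShortExact :=
  ModuleCat.shortComplex_shortExact _ (LinearMap.exact_subtype_mkQ N) N.injective_subtype
    N.mkQ_surjective

variable {M : Type u} [AddCommGroup M] [Module R M] {Y : ModuleCat.{u} R}

theorem subsingleton_ext_congr {M' : Type u} [AddCommGroup M'] [Module R M'] (e : M ≃ₗ[R] M')
    {n : ℕ} (h : Subsingleton (Ext (ModuleCat.of R M) Y n)) :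
    Subsingleton (Ext (ModuleCat.of R M') Y n) := by
  refine subsingleton_of_forall_eq 0 fun x => ?_
  have h1 : (Ext.mk₀ e.toModuleIso.hom).comp x (zero_add n) = 0 := Subsingleton.elim _ _
  have h2 : (Ext.mk₀ e.toModuleIso.inv).comp ((Ext.mk₀ e.toModuleIso.hom).comp x (zero_add n))
      (zero_add n) = x := by
    rw [Ext.mk₀_comp_mk₀_assoc, Iso.inv_hom_id, Ext.mk₀_id_comp]
  rw [← h2, h1, Ext.comp_zero]

theorem subsingleton_ext_of_quotient (N : Submodule R M) {n : ℕ}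
    (h₁ : Subsingleton (Ext (ModuleCat.of R N) Y n))
    (h₂ : Subsingleton (Ext (ModuleCat.of R (M ⧸ N)) Y n)) :
    Subsingleton (Ext (ModuleCat.of R M) Y n) := by
  refine subsingleton_of_forall_eq 0 fun x => ?_
  obtain ⟨y, hy⟩ := Ext.contravariant_sequence_exact₂ (shortExact_subtype_mkQ N) Y x
    (h₁.elim _ _)
  rw [← hy, h₂.elim y 0, Ext.comp_zero]

theorem subsingleton_ext_submodule (N : Submodule R M) {n : ℕ}
    (h₁ : Subsingleton (Ext (ModuleCat.of R M) Y n))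
    (h₂ : Subsingleton (Ext (ModuleCat.of R (M ⧸ N)) Y (n + 1))) :
    Subsingleton (Ext (ModuleCat.of R N) Y n) := by
  refine subsingleton_of_forall_eq 0 fun x => ?_
  obtain ⟨y, hy⟩ := Ext.contravariant_sequence_exact₁ (shortExact_subtype_mkQ N) Y x
    (add_comm 1 n) (h₂.elim _ _)
  rw [← hy, h₁.elim y 0, Ext.comp_zero]

theorem subsingleton_ext_quotient (N : Submodule R M) {n : ℕ}
    (h₁ : Subsingleton (Ext (ModuleCat.of R N) Y n))
    (h₂ : Subsingleton (Ext (ModuleCat.of R M) Y (n + 1))) :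
    Subsingleton (Ext (ModuleCat.of R (M ⧸ N)) Y (n + 1)) := by
  refine subsingleton_of_forall_eq 0 fun x => ?_
  obtain ⟨y, hy⟩ := Ext.contravariant_sequence_exact₃ (shortExact_subtype_mkQ N) Y x
    (h₂.elim _ _) (add_comm 1 n)
  rw [← hy, h₁.elim y 0, Ext.comp_zero]

/-- If every map on N extends to M, the connecting map Hom(N, W) → Ext¹(M/N, W) is zero; it is also
onto because Ext¹(M, W) vanishes. -/
theorem subsingleton_ext_one_quotient_of_extends (N : Submodule R M) {W : Type u}
    [AddCommGroup W] [Module R W]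
    (h₁ : Subsingleton (Ext (ModuleCat.of R M) (ModuleCat.of R W) 1))
    (h₂ : ∀ f : N →ₗ[R] W, ∃ g : M →ₗ[R] W, g ∘ₗ N.subtype = f) :
    Subsingleton (Ext (ModuleCat.of R (M ⧸ N)) (ModuleCat.of R W) 1) := by
  refine subsingleton_of_forall_eq 0 fun x => ?_
  obtain ⟨y, hy⟩ := Ext.contravariant_sequence_exact₃ (shortExact_subtype_mkQ N) _ x
    (h₁.elim _ _) (add_zero 1)
  obtain ⟨f, rfl⟩ := Ext.addEquiv₀.symm.surjective y
  obtain ⟨g, hg⟩ := h₂ f.hom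
  have hf : f = ModuleCat.ofHom N.subtype ≫ ModuleCat.ofHom g := by
    ext x
    exact (LinearMap.congr_fun hg x).symm
  have : Ext.addEquiv₀.symm f = (Ext.mk₀ (ModuleCat.ofHom N.subtype)).comp
      (Ext.mk₀ (ModuleCat.ofHom g)) (zero_add 0) := by
    rw [Ext.mk₀_comp_mk₀, hf]; rfl
  rw [← hy, this]
  exact (shortExact_subtype_mkQ N).extClass_comp_assoc _

theorem subsingleton_ext_self (n : ℕ) : Subsingleton (Ext (ModuleCat.of R R) Y (n + 1)) :=
  Ext.subsingleton_of_projective _ _ n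

theorem subsingleton_ext_quotient_span_singleton {s : R} (hs : s ∈ nonZeroDivisors R) (n : ℕ) :
    Subsingleton (Ext (ModuleCat.of R (R ⧸ Ideal.span {s})) Y (n + 2)) := by
  have hinj : Function.Injective (LinearMap.toSpanSingleton R R s) := fun x y hxy => by
    simpa [mul_cancel_right_mem_nonZeroDivisors hs] using hxy
  have e := (LinearEquiv.ofInjective _ hinj).trans
    (LinearEquiv.ofEq _ _ (LinearMap.range_toSpanSingleton s))
  exact subsingleton_ext_quotient _ (subsingleton_ext_congr e (subsingleton_ext_self n))
    (subsingleton_ext_self (n + 1))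

end ExtVanishing

/-! ### Finite length modules over a local ring and injective dimension one. -/

section Local

variable {R : Type u} [CommRing R] [IsLocalRing R]

theorem nonempty_equiv_residueField (M : Type v) [AddCommGroup M] [Module R M]
    [IsSimpleModule R M] : Nonempty (M ≃ₗ[R] ResidueField R) := by
  obtain ⟨I, hI, ⟨e⟩⟩ := isSimpleModule_iff_quot_maximal.mp (inferInstance : IsSimpleModule R M)
  obtain rfl := eq_maximalIdeal hI
  exact ⟨e⟩

theorem subsingleton_ext_of_isFiniteLength {Y : ModuleCat.{u} R} {n : ℕ}
    (hk : Subsingleton (Ext (ModuleCat.of R (ResidueField R)) Y n))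
    {M : Type u} [AddCommGroup M] [Module R M] (hM : IsFiniteLength R M) :
    Subsingleton (Ext (ModuleCat.of R M) Y n) := by
  induction hM with
  | @of_subsingleton M _ _ _ =>
    refine subsingleton_of_forall_eq 0 fun x => ?_
    have : Limits.IsZero (ModuleCat.of R M) := ModuleCat.isZero_of_subsingleton _
    rw [← Ext.mk₀_id_comp x, this.eq_of_src (𝟙 _) 0, Ext.mk₀_zero, Ext.zero_comp]
  | @of_simple_quotient M _ _ N _ _ ih =>
    obtain ⟨e⟩ := nonempty_equiv_residueField (R := R) (M ⧸ N)
    exact subsingleton_ext_of_quotient N ih (subsingleton_ext_congr e.symm hk)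

theorem exists_submodule_equiv_residueField {M : Type v} [AddCommGroup M] [Module R M]
    [Nontrivial M] (hM : IsFiniteLength R M) :
    ∃ N : Submodule R M, Nonempty (N ≃ₗ[R] ResidueField R) := by
  have := (isFiniteLength_iff_isNoetherian_isArtinian.mp hM).2
  obtain ⟨N, hN⟩ := IsAtomic.exists_atom (Submodule R M)
  have : IsSimpleModule R N := isSimpleModule_iff_isAtom.mpr hN
  exact ⟨N, nonempty_equiv_residueField N⟩

variable {Y : ModuleCat.{u} R} {s : R}

/-- A module of finite injective dimension over a ring of depth one has injective dimension at
most one, as far as modules of finite length can see. -/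
theorem subsingleton_ext_of_hasInjectiveDimensionLE {d : ℕ} (hd : HasInjectiveDimensionLE Y d)
    (hs : s ∈ nonZeroDivisors R) (hsm : s ∈ maximalIdeal R)
    (hfin : IsFiniteLength R (R ⧸ Ideal.span {s})) (n : ℕ)
    {M : Type u} [AddCommGroup M] [Module R M] (hM : IsFiniteLength R M) :
    Subsingleton (Ext (ModuleCat.of R M) Y (n + 2)) := by
  refine subsingleton_ext_of_isFiniteLength ?_ hM
  -- Descending induction on the degree: `k` bounds the steps left until it exceeds the injective
  -- dimension.
  obtain ⟨k, hk⟩ : ∃ k, d + 1 ≤ n + k := ⟨d + 1, by omega⟩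
  induction k generalizing n with
  | zero => exact hd.subsingleton _ _ _ (by omega) _
  | succ k ih =>
    have : Nontrivial (R ⧸ Ideal.span {s}) := Ideal.Quotient.nontrivial_iff.mpr fun h =>
      (mem_maximalIdeal s).mp hsm (Ideal.span_singleton_eq_top.mp h)
    -- The residue field embeds in R/(s), which has projective dimension at most one, so its Ext in
    -- degree n + 2 is controlled by degree n + 3 of the cokernel.
    obtain ⟨N, ⟨e⟩⟩ := exists_submodule_equiv_residueField hfin
    refine subsingleton_ext_congr e (subsingleton_ext_submodule N
      (subsingleton_ext_quotient_span_singleton hs n) ?_)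
    exact subsingleton_ext_of_isFiniteLength (ih (n + 1) (by omega))
      (hfin.of_surjective N.mkQ_surjective)

/-- A nonzero M contains a copy of k, and Ext¹(M, Y) → Ext¹(k, Y) is onto because Ext² of the
cokernel vanishes. -/
theorem subsingleton_of_subsingleton_ext_one
    (h : ∀ (M : Type u) [AddCommGroup M] [Module R M], IsFiniteLength R M →
      Subsingleton (Ext (ModuleCat.of R M) Y 2))
    (hk : ¬ Subsingleton (Ext (ModuleCat.of R (ResidueField R)) Y 1))
    {M : Type u} [AddCommGroup M] [Module R M] (hM : IsFiniteLength R M)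
    (hM' : Subsingleton (Ext (ModuleCat.of R M) Y 1)) : Subsingleton M := by
  by_contra hcon
  have := not_subsingleton_iff_nontrivial.mp hcon
  obtain ⟨N, ⟨e⟩⟩ := exists_submodule_equiv_residueField hM
  exact hk (subsingleton_ext_congr e (subsingleton_ext_submodule N hM'
    (h _ (hM.of_surjective N.mkQ_surjective))))

/-- Duality into a module `W` separates regular ideals. -/
theorem ideal_eq_of_extends {W : Type u} [AddCommGroup W] [Module R W]
    (h : ∀ (M : Type u) [AddCommGroup M] [Module R M], IsFiniteLength R M →
      Subsingleton (Ext (ModuleCat.of R M) (ModuleCat.of R W) 2))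
    (hk : ¬ Subsingleton (Ext (ModuleCat.of R (ResidueField R)) (ModuleCat.of R W) 1))
    {I J : Ideal R} (hIJ : I ≤ J) (hI : IsFiniteLength R (R ⧸ I))
    (hext : ∀ f : I →ₗ[R] W, ∃ g : J →ₗ[R] W, g ∘ₗ Submodule.inclusion hIJ = f) : I = J := by
  have hJ : IsFiniteLength R (R ⧸ J) :=
    hI.of_surjective (f := Submodule.factor hIJ) (Submodule.factor_surjective hIJ)
  have hJ1 := subsingleton_ext_submodule J (subsingleton_ext_self 0) (h _ hJ)
  have hfl : IsFiniteLength R (J ⧸ I.submoduleOf J) :=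
    hI.of_injective (f := (I.submoduleOf J).mapQ I J.subtype le_rfl) <| by
      refine LinearMap.ker_eq_bot.mp (Submodule.ker_liftQ_eq_bot _ _ _ fun x hx => ?_)
      exact (Submodule.Quotient.mk_eq_zero I).mp hx
  -- Extendability gives Ext¹(J/I, W) = 0, hence J/I = 0.
  have := subsingleton_of_subsingleton_ext_one h hk hfl
    (subsingleton_ext_one_quotient_of_extends _ hJ1 fun f => by
      obtain ⟨g, hg⟩ := hext (f ∘ₗ (Submodule.submoduleOfEquivOfLe hIJ).symm.toLinearMap)
      refine ⟨g, LinearMap.ext fun x => ?_⟩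
      have := LinearMap.congr_fun hg (Submodule.submoduleOfEquivOfLe hIJ x)
      rwa [LinearMap.comp_apply, LinearMap.comp_apply, LinearEquiv.coe_coe,
        LinearEquiv.symm_apply_apply] at this)
  rw [Submodule.Quotient.subsingleton_iff] at this
  exact le_antisymm hIJ (Submodule.submoduleOf_eq_top.mp this)

end Local

/-! ### The type as the length of a socle. -/

section Socle

variable {R : Type u} [CommRing R] [IsLocalRing R]

/-- The socle of a module over a local ring. -/
abbrev socle (R : Type u) [CommRing R] [IsLocalRing R] (M : Type v) [AddCommGroup M] [Module R M] :
    Submodule R M :=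
  Submodule.torsionBySet R M (maximalIdeal R : Set R)

theorem length_hom_residueField (M : Type v) [AddCommGroup M] [Module R M] :
    Module.length R (ResidueField R →ₗ[R] M) = Module.length R (socle R M) := by
  let φ : (ResidueField R →ₗ[R] M) →ₗ[R] M := LinearMap.applyₗ (1 : ResidueField R)
  have hφ : Function.Injective φ := fun f g hfg => by
    refine LinearMap.ext fun x => ?_
    obtain ⟨r, rfl⟩ := residue_surjective x
    have h (f : ResidueField R →ₗ[R] M) : f (residue R r) = r • f 1 := by
      rw [← map_smul, Algebra.smul_def, mul_one]; rfl
    rw [h, h]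
    exact congrArg (r • ·) hfg
  have hr : LinearMap.range φ = socle R M := by
    ext x
    constructor
    · rintro ⟨f, rfl⟩
      rw [Submodule.mem_torsionBySet_iff]
      rintro ⟨r, hr⟩
      change r • f 1 = 0
      rw [← map_smul, Algebra.smul_def, mul_one]
      have : algebraMap R (ResidueField R) r = 0 := (residue_eq_zero_iff r).mpr hr
      rw [this, map_zero]
    · intro hx
      rw [Submodule.mem_torsionBySet_iff] at hx
      refine ⟨(maximalIdeal R).liftQ (LinearMap.toSpanSingleton R M x) fun r hr => hx ⟨r, hr⟩, ?_⟩
      exact one_smul R x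
  rw [(LinearEquiv.ofInjective φ hφ).length_eq, hr]

/-- The connecting map Hom(k, R/a) → Ext¹(k, R) of 0 → R → R → R/a → 0 is bijective: a annihilates
k, so Hom(k, R) = 0 and multiplication by a is zero on Ext¹(k, R). -/
theorem length_ext_one_residueField {a : R} (ha : a ∈ nonZeroDivisors R)
    (ham : a ∈ maximalIdeal R) :
    Module.length R (Ext (ModuleCat.of R (ResidueField R)) (ModuleCat.of R R) 1) =
      Module.length R (socle R (R ⧸ Ideal.span {a})) := by
  have hinj : Function.Injective (LinearMap.toSpanSingleton R R a) := fun x y hxy => by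
    simpa [mul_cancel_right_mem_nonZeroDivisors ha] using hxy
  have hex : Function.Exact (LinearMap.toSpanSingleton R R a) (Ideal.span {a}).mkQ := by
    rw [LinearMap.exact_iff, Submodule.ker_mkQ, LinearMap.range_toSpanSingleton]
  have hS : (ModuleCat.shortComplexOfCompEqZero _ _ hex.linearMap_comp_eq_zero).ShortExact :=
    ModuleCat.shortComplex_shortExact _ hex hinj (Submodule.mkQ_surjective _)
  let δ := Ext.postcompOfLinear hS.extClass R (ModuleCat.of R (ResidueField R)) (zero_add 1)
  have hδi : Function.Injective δ := by
    rw [← LinearMap.ker_eq_bot, LinearMap.ker_eq_bot']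
    intro x hx
    obtain ⟨y, hy⟩ := Ext.covariant_sequence_exact₃ _ hS x (zero_add 1) hx
    obtain ⟨f, rfl⟩ := Ext.addEquiv₀.symm.surjective y
    have : f = 0 := by
      ext z
      apply hinj
      have h0 : algebraMap R (ResidueField R) a = 0 := (residue_eq_zero_iff a).mpr ham
      have h1 : a • f.hom z = 0 := by
        rw [← map_smul, Algebra.smul_def, h0, zero_mul, map_zero]
      simpa [mul_comm] using h1
    rw [← hy, this, map_zero, Ext.zero_comp]
  have hδs : Function.Surjective δ := by
    intro x
    refine Ext.covariant_sequence_exact₁ _ hS x ?_ (zero_add 1)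
    have h1 : ModuleCat.ofHom (LinearMap.toSpanSingleton R R a) = a • 𝟙 (ModuleCat.of R R) := by
      ext
      simp
    have h2 : a • 𝟙 (ModuleCat.of R (ResidueField R)) = 0 := by
      ext z
      have h0 : algebraMap R (ResidueField R) a = 0 := (residue_eq_zero_iff a).mpr ham
      have h3 : a • z = 0 := by rw [Algebra.smul_def, h0, zero_mul]
      simpa using h3
    change x.comp (Ext.mk₀ (ModuleCat.ofHom (LinearMap.toSpanSingleton R R a))) _ = 0
    rw [h1, ← Ext.smul_eq_comp_mk₀, ← Ext.mk₀_id_comp x, ← Ext.smul_comp, ← Ext.mk₀_smul, h2,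
      Ext.mk₀_zero, Ext.zero_comp]
  rw [← (LinearEquiv.ofBijective δ ⟨hδi, hδs⟩).length_eq, (Ext.linearEquiv₀ (R := R)).length_eq,
    (ModuleCat.homLinearEquiv (S := R)).length_eq]
  exact length_hom_residueField _

end Socle

/-! ### Canonical duality for fractional ideals. -/

section Duality

theorem div_div_eq_div_mul {R : Type u} [CommRing R] {K : Type v} [CommRing K] [Algebra R K]
    (A B C : Submodule R K) : A / B / C = A / (B * C) := by
  refine le_antisymm ?_ ?_
  · rw [Submodule.le_div_iff_mul_le, mul_comm B C, ← mul_assoc, ← Submodule.le_div_iff_mul_le,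
      ← Submodule.le_div_iff_mul_le]
  · rw [Submodule.le_div_iff_mul_le, Submodule.le_div_iff_mul_le, mul_assoc, mul_comm C B,
      ← Submodule.le_div_iff_mul_le]

variable {R : Type u} [CommRing R] {K : Type v} [CommRing K] [Algebra R K] [IsFractionRing R K]

/-- Every linear map I → C is multiplication by an element of `C : I`. If that element lies in `C :
J`, the map extends to J, so `hsep` applies once I and J have been scaled into R. -/
theorem eq_of_div_le_div {W : Type u} [AddCommGroup W] [Module R W]
    (hsep : ∀ (I J : Ideal R) (hIJ : I ≤ J), IsFiniteLength R (R ⧸ I) →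
      (∀ f : I →ₗ[R] W, ∃ g : J →ₗ[R] W, g ∘ₗ Submodule.inclusion hIJ = f) → I = J)
    (hfl : ∀ s ∈ nonZeroDivisors R, IsFiniteLength R (R ⧸ Ideal.span {s}))
    {C : Submodule R K} (e : C ≃ₗ[R] W) {I J : Submodule R K} (hIJ : I ≤ J)
    {s : R} (hs : s ∈ nonZeroDivisors R) (hsI : algebraMap R K s ∈ I)
    {t : R} (ht : t ∈ nonZeroDivisors R) (htJ : ∀ x ∈ J, ∃ r, algebraMap R K r = algebraMap R K t * x)
    (h : C / I ≤ C / J) : I = J := by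
  obtain ⟨t', ht'⟩ := (IsLocalization.map_units K (⟨t, ht⟩ : nonZeroDivisors R)).exists_left_inv
  obtain ⟨s', hs'⟩ := (IsLocalization.map_units K (⟨s, hs⟩ : nonZeroDivisors R)).exists_left_inv
  replace ht' : t' * algebraMap R K t = 1 := ht'
  replace hs' : s' * algebraMap R K s = 1 := hs'
  -- `ψ` is r ↦ r/t; pulling back along it replaces I and J by the ideals tI ∩ R and tJ.
  let ψ : R →ₗ[R] K := LinearMap.toSpanSingleton R K t'
  have hψ (r : R) : ψ r = algebraMap R K r * t' := by simp [ψ, Algebra.smul_def]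
  have hψJ : ∀ x ∈ J, ∃ r, ψ r = x := fun x hx => by
    obtain ⟨r, hr⟩ := htJ x hx
    exact ⟨r, by rw [hψ, hr, mul_right_comm, mul_comm _ t', ht', one_mul]⟩
  have hts : t * s ∈ I.comap ψ := by
    rw [Submodule.mem_comap, hψ, map_mul, mul_right_comm, mul_comm _ t', ht', one_mul]
    exact hsI
  have hle : I.comap ψ ≤ J.comap ψ := Submodule.comap_mono hIJ
  have key : I.comap ψ = J.comap ψ := by
    refine hsep _ _ hle ?_ fun f => ?_
    · exact (hfl _ (mul_mem ht hs)).of_surjective (f := Submodule.factor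
        ((Ideal.span_singleton_le_iff_mem _).mpr hts)) (Submodule.factor_surjective _)
    · let f' : I.comap ψ →ₗ[R] K := C.subtype ∘ₗ e.symm.toLinearMap ∘ₗ f
      -- Since ψ(ts) = s, the multiplier must be f'(ts)/s.
      let x : K := f' ⟨t * s, hts⟩ * s'
      have hf' (r : I.comap ψ) : f' r = x * ψ r := by
        have h1 : (t * s) • f' r = (r : R) • f' ⟨t * s, hts⟩ := by
          rw [← map_smul, ← map_smul]
          congr 1
          exact Subtype.ext (mul_comm _ _)
        rw [Algebra.smul_def, Algebra.smul_def, map_mul] at h1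
        calc f' r = (t' * algebraMap R K t) * (s' * algebraMap R K s) * f' r := by
              rw [ht', hs', one_mul, one_mul]
          _ = t' * s' * (algebraMap R K t * algebraMap R K s * f' r) := by ring
          _ = x * ψ r := by rw [h1, hψ]; ring
      have hx : x ∈ C / J := h <| Submodule.mem_div_iff_forall_mul_mem.mpr fun y hy => by
        obtain ⟨r, rfl⟩ := hψJ y (hIJ hy)
        rw [← hf' ⟨r, hy⟩]
        exact (e.symm (f ⟨r, hy⟩)).2
      let g : J.comap ψ →ₗ[R] C := LinearMap.codRestrict C
        (LinearMap.mulLeft R x ∘ₗ ψ ∘ₗ (J.comap ψ).subtype) fun r =>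
          Submodule.mem_div_iff_forall_mul_mem.mp hx _ r.2
      refine ⟨e.toLinearMap ∘ₗ g, LinearMap.ext fun r => ?_⟩
      apply e.symm.injective
      apply Subtype.ext
      change (e.symm (e (g (Submodule.inclusion hle r))) : K) = f' r
      rw [e.symm_apply_apply, hf']
      rfl
  refine le_antisymm hIJ fun x hx => ?_
  obtain ⟨r, rfl⟩ := hψJ x hx
  change r ∈ I.comap ψ
  rw [key]
  exact hx

theorem exists_common_denominator {I : Submodule R K} (hI : I.FG) :
    ∃ t ∈ nonZeroDivisors R, ∀ x ∈ I, ∃ r, algebraMap R K r = algebraMap R K t * x := by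
  obtain ⟨t, ht, h⟩ := FractionalIdeal.isFractional_of_fg (S := nonZeroDivisors R) hI
  refine ⟨t, ht, fun x hx => ?_⟩
  obtain ⟨r, hr⟩ := h x hx
  exact ⟨r, by rw [hr, Algebra.smul_def]⟩

/-- I and its bidual have the same dual, so the separation property identifies them. -/
theorem div_div_eq_self {W : Type u} [AddCommGroup W] [Module R W]
    (hsep : ∀ (I J : Ideal R) (hIJ : I ≤ J), IsFiniteLength R (R ⧸ I) →
      (∀ f : I →ₗ[R] W, ∃ g : J →ₗ[R] W, g ∘ₗ Submodule.inclusion hIJ = f) → I = J)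
    (hfl : ∀ s ∈ nonZeroDivisors R, IsFiniteLength R (R ⧸ Ideal.span {s}))
    {C : Submodule R K} (e : C ≃ₗ[R] W) (hC : C.FG) (h1 : 1 ≤ C) {I : Submodule R K} (hI : I.FG)
    {s : R} (hs : s ∈ nonZeroDivisors R) (hsI : algebraMap R K s ∈ I) : C / (C / I) = I := by
  have hle : I ≤ C / (C / I) := fun x hx => Submodule.mem_div_iff_forall_mul_mem.mpr fun y hy => by
    rw [mul_comm]
    exact Submodule.mem_div_iff_forall_mul_mem.mp hy x hx
  obtain ⟨t, ht, htI⟩ := exists_common_denominator hI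
  obtain ⟨w, hw, hwC⟩ := exists_common_denominator hC
  -- A denominator of the bidual: t lies in `C : I` because tI ⊆ R ⊆ C, so t carries the bidual into
  -- C, and w carries C into R.
  refine (eq_of_div_le_div hsep hfl e hle hs hsI (mul_mem hw ht) (fun x hx => ?_) ?_).symm
  · have ht' : algebraMap R K t ∈ C / I := Submodule.mem_div_iff_forall_mul_mem.mpr fun y hy => by
      obtain ⟨r, hr⟩ := htI y hy
      rw [← hr]
      exact h1 (Submodule.mem_one.mpr ⟨r, rfl⟩)
    obtain ⟨r, hr⟩ := hwC _ (Submodule.mem_div_iff_forall_mul_mem.mp hx _ ht')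
    exact ⟨r, by rw [hr, map_mul]; ring⟩
  · exact fun x hx => Submodule.mem_div_iff_forall_mul_mem.mpr fun y hy => by
      rw [mul_comm]
      exact Submodule.mem_div_iff_forall_mul_mem.mp hy x hx

/-- An element x of `R : C` acts as a map C → R whose value at 1 is x. -/
theorem one_div_le_map_traceIdeal {W : Type u} [AddCommGroup W] [Module R W] {C : Submodule R K}
    (e : C ≃ₗ[R] W) (h1 : 1 ≤ C) :
    1 / C ≤ Submodule.map (Algebra.linearMap R K) (traceIdeal R W) := by
  intro x hx
  have hinj : Function.Injective (Algebra.linearMap R K) := IsFractionRing.injective R K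
  let i : R ≃ₗ[R] (1 : Submodule R K) :=
    (LinearEquiv.ofInjective _ hinj).trans (LinearEquiv.ofEq _ _ Submodule.one_eq_range.symm)
  let g : C →ₗ[R] (1 : Submodule R K) := LinearMap.codRestrict _
    (LinearMap.mulLeft R x ∘ₗ C.subtype) fun y => Submodule.mem_div_iff_forall_mul_mem.mp hx _ y.2
  let f : W →ₗ[R] R := i.symm.toLinearMap ∘ₗ g ∘ₗ e.symm.toLinearMap
  have h1C : (1 : K) ∈ C := Submodule.one_le.mp h1
  refine ⟨f (e ⟨1, h1C⟩), le_iSup (fun f : W →ₗ[R] R => LinearMap.range f) f ⟨_, rfl⟩, ?_⟩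
  have : (i (f (e ⟨1, h1C⟩)) : K) = x := by
    simp only [f, LinearMap.comp_apply, LinearEquiv.coe_coe, LinearEquiv.symm_apply_apply,
      LinearEquiv.apply_symm_apply]
    exact mul_one x
  exact this

variable [IsLocalRing R]

/-- The minimal number of generators of C is at most the type of R. For mC ⊆ F ⊆ C, the dual `C : F`
lies between `C : C = R` and `C : mC = R : m`, and multiplication by a identifies (R : m)/R with the
socle of R/a. Biduality makes F ↦ `C : F` strictly order-reversing, which compares lengths. -/
theorem length_quotient_maximalIdeal_smul_le {C : Submodule R K} (h1 : 1 ≤ C)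
    (hCC : C / C = 1) {a : R} (ha : a ∈ nonZeroDivisors R) (ham : a ∈ maximalIdeal R)
    (hdd : ∀ I ≤ C, algebraMap R K a ∈ I → C / (C / I) = I) :
    Module.length R (C ⧸ (maximalIdeal R • ⊤ : Submodule R C)) ≤
      Module.length R (socle R (R ⧸ Ideal.span {a})) := by
  obtain ⟨b, hb⟩ := (IsLocalization.map_units K (⟨a, ha⟩ : nonZeroDivisors R)).exists_left_inv
  replace hb : b * algebraMap R K a = 1 := hb
  let ψ : R →ₗ[R] K := LinearMap.toSpanSingleton R K b
  have hψ (r : R) : ψ r = algebraMap R K r * b := by simp [ψ, Algebra.smul_def]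
  let F (P : Submodule R (C ⧸ (maximalIdeal R • ⊤ : Submodule R C))) : Submodule R K :=
    (P.comap (Submodule.mkQ _)).map C.subtype
  have hFC P : F P ≤ C := Submodule.map_subtype_le _ _
  have hmF P : ∀ r ∈ maximalIdeal R, ∀ y ∈ C, algebraMap R K r * y ∈ F P := fun r hr y hy => by
    rw [← Algebra.smul_def]
    refine ⟨r • ⟨y, hy⟩, ?_, rfl⟩
    have : (Submodule.mkQ (maximalIdeal R • ⊤ : Submodule R C)) (r • ⟨y, hy⟩) = 0 :=
      (Submodule.Quotient.mk_eq_zero _).mpr (Submodule.smul_mem_smul hr trivial)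
    change _ ∈ P
    rw [this]
    exact P.zero_mem
  have haF P : algebraMap R K a ∈ F P := by
    simpa using hmF P a ham 1 (Submodule.one_le.mp h1)
  have hFle P Q : F P ≤ F Q ↔ P ≤ Q := by
    rw [Submodule.map_le_map_iff_of_injective C.injective_subtype,
      Submodule.comap_le_comap_iff_of_surjective (Submodule.mkQ_surjective _)]
  -- `T P` is the image of a(C : F P) in the socle of R/a.
  let T (P : Submodule R (C ⧸ (maximalIdeal R • ⊤ : Submodule R C))) :
      Submodule R (socle R (R ⧸ Ideal.span {a})) :=
    (((C / F P).comap ψ).map (Ideal.span {a}).mkQ).comap (Submodule.subtype _)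
  have hTle P Q (h : T P ≤ T Q) : Q ≤ P := by
    rw [← hFle, ← hdd _ (hFC Q) (haF Q), ← hdd _ (hFC P) (haF P)]
    suffices hs : C / F P ≤ C / F Q from fun x hx =>
      Submodule.mem_div_iff_forall_mul_mem.mpr fun y hy =>
        Submodule.mem_div_iff_forall_mul_mem.mp hx y (hs hy)
    intro x hx
    have hxm : ∀ r ∈ maximalIdeal R, ∃ ρ, algebraMap R K ρ = x * algebraMap R K r := fun r hr => by
      refine Submodule.mem_one.mp (hCC ▸ Submodule.mem_div_iff_forall_mul_mem.mpr fun y hy => ?_)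
      rw [mul_assoc]
      exact Submodule.mem_div_iff_forall_mul_mem.mp hx _ (hmF P r hr y hy)
    obtain ⟨ρ, hρ⟩ := hxm a ham
    have hψρ : ψ ρ = x := by rw [hψ, hρ, mul_assoc, mul_comm _ b, hb, mul_one]
    have hsoc : (Ideal.span {a}).mkQ ρ ∈ socle R (R ⧸ Ideal.span {a}) := by
      rw [Submodule.mem_torsionBySet_iff]
      rintro ⟨r, hr⟩
      obtain ⟨ρ', hρ'⟩ := hxm r hr
      change r • (Ideal.span {a}).mkQ ρ = 0
      rw [← map_smul]
      refine (Submodule.Quotient.mk_eq_zero _).mpr (Ideal.mem_span_singleton'.mpr ⟨ρ', ?_⟩)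
      apply IsFractionRing.injective R K
      rw [map_mul, smul_eq_mul, map_mul, hρ', hρ]
      ring
    have hTP : (⟨_, hsoc⟩ : socle R (R ⧸ Ideal.span {a})) ∈ T P :=
      ⟨ρ, by rwa [SetLike.mem_coe, Submodule.mem_comap, hψρ], rfl⟩
    obtain ⟨ρ', hρ', heq⟩ := h hTP
    obtain ⟨z, hz⟩ := Ideal.mem_span_singleton'.mp ((Submodule.Quotient.eq _).mp heq)
    have hz' : ψ ρ' - ψ ρ = algebraMap R K z := by
      rw [← map_sub, hψ, ← hz, map_mul, mul_assoc, mul_comm _ b, hb, mul_one]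
    have hzF : algebraMap R K z ∈ C / F Q := Submodule.mem_div_iff_forall_mul_mem.mpr fun y hy => by
      rw [← Algebra.smul_def]
      exact C.smul_mem _ (hFC Q hy)
    have : x = ψ ρ' - algebraMap R K z := by rw [← hz', hψρ]; ring
    rw [this]
    exact (C / F Q).sub_mem hρ' hzF
  have hTanti P Q (h : P ≤ Q) : T Q ≤ T P :=
    Submodule.comap_mono <| Submodule.map_mono <| Submodule.comap_mono fun x hx =>
      Submodule.mem_div_iff_forall_mul_mem.mpr fun y hy =>
        Submodule.mem_div_iff_forall_mul_mem.mp hx y ((hFle P Q).mpr h hy)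
  -- Length is the Krull dimension of the submodule lattice, so a strictly monotone map into the
  -- order dual suffices.
  rw [← WithBot.coe_le_coe, Module.coe_length, Module.coe_length,
    ← Order.krullDim_orderDual (α := Submodule R (socle R (R ⧸ Ideal.span {a})))]
  refine Order.krullDim_le_of_strictMono (fun P => OrderDual.toDual (T P)) fun P Q hPQ => ?_
  exact lt_of_le_not_ge (hTanti P Q hPQ.le) fun h => hPQ.not_ge (hTle P Q h)

end Duality

/-! ### Nakayama and numbers of generators. -/

section Generators

variable {R : Type u} [CommRing R] [IsLocalRing R] {M : Type v} [AddCommGroup M] [Module R M]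

theorem exists_span_pair_eq_top [Module.Finite R M]
    (h : Module.length R (M ⧸ (maximalIdeal R • ⊤ : Submodule R M)) ≤ 2) :
    ∃ x y : M, Submodule.span R {x, y} = ⊤ := by
  let _ : Module (ResidueField R) (M ⧸ (maximalIdeal R • ⊤ : Submodule R M)) :=
    inferInstanceAs (Module (R ⧸ maximalIdeal R) _)
  have : IsScalarTower R (ResidueField R) (M ⧸ (maximalIdeal R • ⊤ : Submodule R M)) :=
    inferInstanceAs (IsScalarTower R (R ⧸ maximalIdeal R) _)
  have : Module.Finite (ResidueField R) (M ⧸ (maximalIdeal R • ⊤ : Submodule R M)) :=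
    Module.Finite.of_restrictScalars_finite R _ _
  rw [Module.length_eq_of_surjective (R := ResidueField R) residue_surjective,
    Module.length_eq_finrank] at h
  norm_cast at h
  let b := Module.finBasis (ResidueField R) (M ⧸ (maximalIdeal R • ⊤ : Submodule R M))
  choose f hf using fun i => Submodule.mkQ_surjective (maximalIdeal R • ⊤ : Submodule R M) (b i)
  have hspan : Submodule.span R (Set.range f) = ⊤ := by
    rw [← IsLocalRing.map_mkQ_eq_top, Submodule.map_span, ← Set.range_comp]
    have : (Submodule.mkQ (maximalIdeal R • ⊤ : Submodule R M)) ∘ f = b := funext hf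
    rw [this, ← Submodule.restrictScalars_span R (ResidueField R) residue_surjective, b.span_eq,
      Submodule.restrictScalars_top]
  clear_value b
  clear hf b
  generalize Module.finrank (ResidueField R) (M ⧸ (maximalIdeal R • ⊤ : Submodule R M)) = n at *
  -- There may be fewer than two basis vectors; the missing ones are padded with 0.
  let g (i : ℕ) : M := if hi : i < n then f ⟨i, hi⟩ else 0
  refine ⟨g 0, g 1, eq_top_iff.mpr (hspan ▸ Submodule.span_mono ?_)⟩
  rintro _ ⟨⟨i, hi⟩, rfl⟩
  obtain rfl | rfl : i = 0 ∨ i = 1 := by omega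
  · left; simp [g, hi]
  · right; simp [g, hi]

theorem length_quotient_maximalIdeal_smul_le_card (s : Finset M)
    (hs : Submodule.span R (s : Set M) = ⊤) :
    Module.length R (M ⧸ (maximalIdeal R • ⊤ : Submodule R M)) ≤ s.card := by
  classical
  let _ : Module (ResidueField R) (M ⧸ (maximalIdeal R • ⊤ : Submodule R M)) :=
    inferInstanceAs (Module (R ⧸ maximalIdeal R) _)
  have : IsScalarTower R (ResidueField R) (M ⧸ (maximalIdeal R • ⊤ : Submodule R M)) :=
    inferInstanceAs (IsScalarTower R (R ⧸ maximalIdeal R) _)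
  have : Module.Finite R M := ⟨⟨s, hs⟩⟩
  have : Module.Finite (ResidueField R) (M ⧸ (maximalIdeal R • ⊤ : Submodule R M)) :=
    Module.Finite.of_restrictScalars_finite R _ _
  rw [Module.length_eq_of_surjective (R := ResidueField R) residue_surjective,
    Module.length_eq_finrank]
  norm_cast
  let t := s.image (Submodule.mkQ (maximalIdeal R • ⊤ : Submodule R M))
  have ht : Submodule.span (ResidueField R)
      (t : Set (M ⧸ (maximalIdeal R • ⊤ : Submodule R M))) = ⊤ := by
    rw [← Submodule.restrictScalars_eq_top_iff R,
      Submodule.restrictScalars_span R (ResidueField R) residue_surjective, Finset.coe_image,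
      ← Submodule.map_span, hs, Submodule.map_top, Submodule.range_mkQ]
  calc _ = Module.finrank (ResidueField R) (Submodule.span (ResidueField R)
          (t : Set (M ⧸ (maximalIdeal R • ⊤ : Submodule R M)))) := by
        rw [ht, finrank_top]
    _ ≤ t.card := finrank_span_finset_le_card t
    _ ≤ s.card := Finset.card_image_le

end Generators

/-! ### Comparison of lengths modulo a nonzerodivisor. -/

section Lengths

variable {R : Type u} [CommRing R] {M : Type v} [AddCommGroup M] [Module R M]

theorem isFiniteLength_quotient_of_smul_mem [IsNoetherianRing R] [Module.Finite R M] {t : R}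
    (ht : IsFiniteLength R (R ⧸ Ideal.span {t})) {N : Submodule R M} (hN : ∀ x : M, t • x ∈ N) :
    IsFiniteLength R (M ⧸ N) := by
  have h1 : IsFiniteLength R (M ⧸ (Ideal.span {t} • ⊤ : Submodule R M)) := by
    have h2 : IsArtinian R (R ⧸ Ideal.span {t}) :=
      (isFiniteLength_iff_isNoetherian_isArtinian.mp ht).2
    have h3 : IsArtinianRing (R ⧸ Ideal.span {t}) := isArtinian_of_tower R h2
    have : Module.Finite (R ⧸ Ideal.span {t}) (M ⧸ (Ideal.span {t} • ⊤ : Submodule R M)) :=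
      Module.Finite.of_restrictScalars_finite R _ _
    refine isFiniteLength_iff_isNoetherian_isArtinian.mpr ⟨inferInstance, ?_⟩
    have : IsArtinian (R ⧸ Ideal.span {t}) (M ⧸ (Ideal.span {t} • ⊤ : Submodule R M)) :=
      inferInstance
    exact isArtinian_of_surjective_algebraMap (R := R ⧸ Ideal.span {t}) Ideal.Quotient.mk_surjective
  have hle : (Ideal.span {t} • ⊤ : Submodule R M) ≤ N := by
    rw [Submodule.ideal_span_singleton_smul]
    rintro _ ⟨x, -, rfl⟩
    exact hN x
  exact h1.of_surjective (f := Submodule.factor hle) (Submodule.factor_surjective hle)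

/-- Compute ℓ(M/a f(R)) through f(R) and through aM. Multiplication by a gives M/f(R) ≅ aM/a f(R),
and this common finite length cancels. -/
theorem length_quotient_span_singleton_eq {a : R} (ha : Function.Injective fun x : M => a • x)
    {f : R →ₗ[R] M} (hf : Function.Injective f)
    (hfl : IsFiniteLength R (M ⧸ LinearMap.range f)) :
    Module.length R (R ⧸ Ideal.span {a}) =
      Module.length R (M ⧸ LinearMap.range (LinearMap.lsmul R M a)) := by
  let N : Submodule R M := Submodule.span R {a • f 1}
  have hN : ∀ x, x ∈ N ↔ ∃ r, a • f r = x := fun x => by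
    rw [Submodule.mem_span_singleton]
    refine exists_congr fun r => ?_
    rw [smul_comm, ← map_smul, smul_eq_mul, mul_one]
  have hNf : N ≤ LinearMap.range f := fun x hx => by
    obtain ⟨r, rfl⟩ := (hN x).mp hx
    exact ⟨a • r, map_smul _ _ _⟩
  have hNa : N ≤ LinearMap.range (LinearMap.lsmul R M a) := fun x hx => by
    obtain ⟨r, rfl⟩ := (hN x).mp hx
    exact ⟨f r, rfl⟩
  have hi₁ : Ideal.span {a} ≤ N.comap f := by
    rw [Ideal.span_singleton_le_iff_mem]
    exact (hN _).mpr ⟨1, by rw [← map_smul, smul_eq_mul, mul_one]⟩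
  have hi₂ : LinearMap.range f ≤ N.comap (LinearMap.lsmul R M a) := by
    rintro _ ⟨r, rfl⟩
    exact (hN _).mpr ⟨r, rfl⟩
  have e₁ := Module.length_eq_add_of_exact (Submodule.mapQ _ N f hi₁) (Submodule.factor hNf)
    (by
      refine LinearMap.ker_eq_bot.mp (Submodule.ker_liftQ_eq_bot _ _ _ fun r hr => ?_)
      obtain ⟨s, hs⟩ := (hN _).mp ((Submodule.Quotient.mk_eq_zero N).mp hr)
      rw [← map_smul] at hs
      rw [← hf hs]
      exact Ideal.mem_span_singleton'.mpr ⟨s, mul_comm _ _⟩)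
    (Submodule.factor_surjective hNf)
    (fun x => by
      obtain ⟨x, rfl⟩ := N.mkQ_surjective x
      constructor
      · intro hx
        obtain ⟨r, rfl⟩ := (Submodule.Quotient.mk_eq_zero _).mp hx
        exact ⟨Submodule.Quotient.mk r, rfl⟩
      · rintro ⟨r, hr⟩
        obtain ⟨r, rfl⟩ := Submodule.mkQ_surjective _ r
        rw [← hr]
        exact (Submodule.Quotient.mk_eq_zero _).mpr ⟨r, rfl⟩)
  have e₂ := Module.length_eq_add_of_exact (Submodule.mapQ _ N (LinearMap.lsmul R M a) hi₂)
    (Submodule.factor hNa)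
    (by
      refine LinearMap.ker_eq_bot.mp (Submodule.ker_liftQ_eq_bot _ _ _ fun x hx => ?_)
      obtain ⟨s, hs⟩ := (hN _).mp ((Submodule.Quotient.mk_eq_zero N).mp hx)
      exact ⟨s, ha hs⟩)
    (Submodule.factor_surjective hNa)
    (fun x => by
      obtain ⟨x, rfl⟩ := N.mkQ_surjective x
      constructor
      · intro hx
        obtain ⟨y, rfl⟩ := (Submodule.Quotient.mk_eq_zero _).mp hx
        exact ⟨Submodule.Quotient.mk y, rfl⟩
      · rintro ⟨y, hy⟩
        obtain ⟨y, rfl⟩ := Submodule.mkQ_surjective _ y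
        rw [← hy]
        exact (Submodule.Quotient.mk_eq_zero _).mpr ⟨y, rfl⟩)
  rw [e₁, add_comm] at e₂
  exact ENat.add_right_injective_of_ne_top (Module.length_ne_top_iff.mpr hfl) e₂

end Lengths

/-! ### Reductions and integral dependence. -/

section Integrality

/-- The determinant trick: the unit in N makes N faithful over its multiplier ring, which therefore
embeds in the integral algebra `Module.End R N`. -/
theorem isIntegral_of_mul_mem_submodule {R : Type u} [CommRing R] {A : Type v} [CommRing A]
    [Algebra R A] {N : Submodule R A} (hN : N.FG) {a : A} (ha : a ∈ N) (hau : IsUnit a) {x : A}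
    (hx : ∀ n ∈ N, x * n ∈ N) : IsIntegral R x := by
  let A' : Subalgebra R A :=
    { carrier := { x | ∀ n ∈ N, x * n ∈ N }
      mul_mem' := fun {a b} ha hb n hn => (mul_assoc a b n).symm ▸ ha _ (hb _ hn)
      one_mem' := fun n hn => (one_mul n).symm ▸ hn
      add_mem' := fun {a b} ha hb n hn => (add_mul a b n).symm ▸ N.add_mem (ha _ hn) (hb _ hn)
      zero_mem' := fun n _ => (zero_mul n).symm ▸ N.zero_mem
      algebraMap_mem' := fun r n hn => (Algebra.smul_def r n) ▸ N.smul_mem r hn }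
  let f : A' →ₐ[R] Module.End R N :=
    AlgHom.ofLinearMap
      { toFun := fun x => (LinearMap.mulLeft R (x : A)).restrict x.prop
        map_add' := by intro x y; ext; exact add_mul _ _ _
        map_smul' := by intro r s; ext; exact smul_mul_assoc _ _ _ }
      (by ext; exact one_mul _)
      (by intro x y; ext; exact mul_assoc _ _ _)
  have hf : Function.Injective f := fun y z hyz => by
    have : (y : A) * a = z * a := congrArg Subtype.val (LinearMap.congr_fun hyz ⟨a, ha⟩)
    exact Subtype.ext (hau.mul_right_cancel this)
  have : Module.Finite R N := by rwa [Module.Finite.iff_fg]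
  have hfx : IsIntegral R (f ⟨x, hx⟩) := Algebra.IsIntegral.isIntegral _
  exact ((isIntegral_algHom_iff (R := R) (A := A') (B := Module.End R N) f hf).mp hfx).map A'.val

/-- If `(a)` is a reduction of `I`, then `I` and `(a)` have the same extension to the integral
closure. -/
theorem exists_isIntegral_of_isReduction {R : Type u} [CommRing R] [IsNoetherianRing R]
    {K : Type v} [CommRing K] [Algebra R K] {a : R} (ha : IsUnit (algebraMap R K a)) {I : Ideal R}
    (hI : IsReduction (Ideal.span {a}) I) {r : R} (hr : r ∈ I) :
    ∃ z : K, IsIntegral R z ∧ algebraMap R K a * z = algebraMap R K r := by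
  obtain ⟨b, hb⟩ := ha.exists_right_inv
  obtain ⟨hle, n, hn⟩ := hI
  refine ⟨b * algebraMap R K r, ?_, by rw [← mul_assoc, hb, one_mul]⟩
  have haI : a ∈ I := hle (Ideal.mem_span_singleton_self a)
  -- The fraction r/a stabilizes Iⁿ, since rIⁿ ⊆ Iⁿ⁺¹ = aIⁿ.
  refine isIntegral_of_mul_mem_submodule (N := Submodule.map (Algebra.linearMap R K) (I ^ n))
    ((IsNoetherian.noetherian (I ^ n)).map _) (a := algebraMap R K (a ^ n))
    ⟨a ^ n, Ideal.pow_mem_pow haI n, rfl⟩ (by rw [map_pow]; exact ha.pow n) ?_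
  rintro _ ⟨y, hy, rfl⟩
  have : r * y ∈ Ideal.span {a} * I ^ n := by
    rw [hn, pow_succ']
    exact Ideal.mul_mem_mul hr hy
  obtain ⟨w, hw, h⟩ := Ideal.mem_span_singleton_mul.mp this
  refine ⟨w, hw, ?_⟩
  change algebraMap R K w = b * algebraMap R K r * algebraMap R K y
  rw [mul_assoc, ← map_mul, ← h, map_mul, ← mul_assoc, mul_comm b, hb, one_mul]

end Integrality

/-! ### From the socle of R/a to m² = am and the Hilbert function. -/

section MinimalMultiplicity

theorem length_quotient_eq_add {R : Type u} [CommRing R] {I J : Ideal R} (hIJ : I ≤ J) :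
    Module.length R (R ⧸ I) = Module.length R (J ⧸ I.submoduleOf J) + Module.length R (R ⧸ J) := by
  refine Module.length_eq_add_of_exact ((I.submoduleOf J).mapQ I J.subtype le_rfl)
    (Submodule.factor hIJ) (LinearMap.ker_eq_bot.mp (Submodule.ker_liftQ_eq_bot _ _ _ fun x hx =>
      (Submodule.Quotient.mk_eq_zero I).mp hx)) (Submodule.factor_surjective hIJ) fun x => ?_
  obtain ⟨x, rfl⟩ := I.mkQ_surjective x
  constructor
  · intro hx
    exact ⟨Submodule.Quotient.mk ⟨x, (Submodule.Quotient.mk_eq_zero _).mp hx⟩, rfl⟩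
  · rintro ⟨r, hr⟩
    obtain ⟨r, rfl⟩ := Submodule.mkQ_surjective _ r
    rw [← hr]
    exact (Submodule.Quotient.mk_eq_zero _).mpr r.2

variable {R : Type u} [CommRing R] [IsLocalRing R]

theorem length_cotangent {R : Type u} [CommRing R] (I : Ideal R) :
    Module.length R I.Cotangent = Module.length R (I ⧸ (I ^ 2).submoduleOf I) := by
  rw [← (I.toCotangent.quotKerEquivOfSurjective I.toCotangent_surjective).length_eq]
  refine (Submodule.quotEquivOfEq _ _ (Submodule.ext fun x => ?_)).length_eq
  exact I.mem_toCotangent_ker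

theorem length_residueField : Module.length R (R ⧸ maximalIdeal R) = 1 := by
  rw [Module.length_eq_one_iff, isSimpleModule_iff_isCoatom]
  exact (maximalIdeal.isMaximal R).out

/-- A socle of length 2 is a proper submodule inside m/(a), so R/a has length at least 3. With
equality the socle is a maximal submodule, hence equals m/(a), which says m² ⊆ (a). -/
theorem length_quotient_eq_three_of_socle {a : R} (ham : a ∈ maximalIdeal R)
    (hlen : Module.length R (R ⧸ Ideal.span {a}) ≤ 3)
    (hsoc : Module.length R (socle R (R ⧸ Ideal.span {a})) = 2) :
    Module.length R (R ⧸ Ideal.span {a}) = 3 ∧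
      maximalIdeal R * maximalIdeal R ≤ Ideal.span {a} := by
  set S := socle R (R ⧸ Ideal.span {a}) with hS
  let N : Submodule R (R ⧸ Ideal.span {a}) :=
    Submodule.map (Ideal.span {a}).mkQ (maximalIdeal R)
  have hmem (x : R) : (Ideal.span {a}).mkQ x ∈ S ↔ ∀ y ∈ maximalIdeal R, y * x ∈ Ideal.span {a} := by
    rw [hS, Submodule.mem_torsionBySet_iff]
    constructor
    · intro h y hy
      exact (Submodule.Quotient.mk_eq_zero _).mp (h ⟨y, hy⟩)
    · rintro h ⟨y, hy⟩
      exact (Submodule.Quotient.mk_eq_zero _).mpr (h y hy)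
  have hSN : S ≤ N := by
    intro x hx
    obtain ⟨x, rfl⟩ := Submodule.mkQ_surjective _ x
    by_contra hcon
    have hxu : IsUnit x := by
      by_contra hxu
      exact hcon ⟨x, (mem_maximalIdeal x).mpr hxu, rfl⟩
    -- A unit representing a socle element forces m = (a), so R/a = k is too short for a socle of
    -- length 2.
    have hma : maximalIdeal R = Ideal.span {a} := by
      refine le_antisymm (fun y hy => ?_) ((Ideal.span_singleton_le_iff_mem _).mpr ham)
      exact (Ideal.mul_unit_mem_iff_mem _ hxu).mp ((hmem x).mp hx y hy)
    have h1 : Module.length R S ≤ 1 := by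
      refine (Module.length_le_of_injective S.subtype S.injective_subtype).trans ?_
      rw [← hma, length_residueField]
    rw [hsoc] at h1
    exact absurd h1 (by decide)
  have hN : N ≠ ⊤ := by
    intro h
    have h1 : (Ideal.span {a}).mkQ 1 ∈ N := h ▸ trivial
    obtain ⟨y, hy, hy1⟩ := h1
    have h2 : y - 1 ∈ Ideal.span {a} := (Submodule.Quotient.eq _).mp hy1
    have h3 : y - 1 ∈ maximalIdeal R := (Ideal.span_singleton_le_iff_mem _).mpr ham h2
    have h4 : (1 : R) ∈ maximalIdeal R := by simpa using sub_mem hy h3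
    exact (Ideal.ne_top_iff_one _).mp (maximalIdeal.isMaximal R).ne_top h4
  have hadd := Module.length_eq_add_of_exact S.subtype S.mkQ S.injective_subtype S.mkQ_surjective
    (LinearMap.exact_subtype_mkQ S)
  have hnt : Nontrivial ((R ⧸ Ideal.span {a}) ⧸ S) :=
    Submodule.Quotient.nontrivial_iff.mpr fun h => hN (top_le_iff.mp (h ▸ hSN))
  have hpos := Order.one_le_iff_pos.mpr (Module.length_pos (R := R) (M := (R ⧸ Ideal.span {a}) ⧸ S))
  rw [hsoc] at hadd
  have hone : Module.length R ((R ⧸ Ideal.span {a}) ⧸ S) = 1 := by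
    refine le_antisymm ?_ hpos
    rw [hadd, show (3 : ℕ∞) = 2 + 1 from rfl] at hlen
    exact (ENat.add_le_add_iff_left (by decide)).mp hlen
  refine ⟨by rw [hadd, hone]; rfl, ?_⟩
  have hco : IsCoatom S := isSimpleModule_iff_isCoatom.mp (Module.length_eq_one_iff.mp hone)
  have hSeq : N = S := (hco.le_iff.mp hSN).resolve_left hN
  rw [Ideal.mul_le]
  intro x hx y hy
  exact (hmem y).mp (hSeq ▸ ⟨y, hy, rfl⟩) x hx

/-- If az ∈ m² with z a unit, then a ∈ m², so mⁿ⁺¹ = amⁿ ⊆ mⁿ⁺². Nakayama gives mⁿ⁺¹ = 0, impossible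
since m contains a nonzerodivisor. -/
theorem maximalIdeal_mul_self_eq [IsNoetherianRing R] {a : R} (ha : a ∈ nonZeroDivisors R)
    (hred : IsReduction (Ideal.span {a}) (maximalIdeal R))
    (h : maximalIdeal R * maximalIdeal R ≤ Ideal.span {a}) :
    maximalIdeal R * maximalIdeal R = Ideal.span {a} * maximalIdeal R := by
  obtain ⟨hle, n, hn⟩ := hred
  have ham : a ∈ maximalIdeal R := hle (Ideal.mem_span_singleton_self a)
  refine le_antisymm (fun w hw => ?_) (Ideal.mul_mono_left hle)
  obtain ⟨z, rfl⟩ := Ideal.mem_span_singleton.mp (h hw)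
  refine Ideal.mem_span_singleton_mul.mpr ⟨z, ?_, rfl⟩
  by_contra hz
  have hzu : IsUnit z := by rwa [mem_maximalIdeal, mem_nonunits_iff, not_not] at hz
  have ha2 : a ∈ maximalIdeal R * maximalIdeal R := (Ideal.mul_unit_mem_iff_mem _ hzu).mp hw
  have hbot : maximalIdeal R ^ (n + 1) = ⊥ := by
    refine Submodule.eq_bot_of_le_smul_of_le_jacobson_bot (maximalIdeal R) _
      (IsNoetherian.noetherian _) ?_ (maximalIdeal_le_jacobson _)
    calc maximalIdeal R ^ (n + 1) = Ideal.span {a} * maximalIdeal R ^ n := hn.symm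
      _ ≤ maximalIdeal R * maximalIdeal R * maximalIdeal R ^ n :=
        Ideal.mul_mono_left ((Ideal.span_singleton_le_iff_mem _).mpr ha2)
      _ = maximalIdeal R • maximalIdeal R ^ (n + 1) := by
        rw [smul_eq_mul, mul_assoc, ← pow_succ']
  have h0 : a ^ (n + 1) = 0 := by
    rw [← Ideal.mem_bot, ← hbot]
    exact Ideal.pow_mem_pow ham _
  exact nonZeroDivisors.ne_zero (pow_mem ha (n + 1)) h0

theorem maximalIdeal_pow_add_two {a : R}
    (h : maximalIdeal R * maximalIdeal R = Ideal.span {a} * maximalIdeal R) (n : ℕ) :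
    maximalIdeal R ^ (n + 2) = Ideal.span {a} * maximalIdeal R ^ (n + 1) := by
  rw [pow_add, pow_two, h, pow_succ]
  ring

theorem range_lsmul_maximalIdeal_pow {a : R}
    (h : maximalIdeal R * maximalIdeal R = Ideal.span {a} * maximalIdeal R) (n : ℕ) :
    LinearMap.range (LinearMap.lsmul R ↥(maximalIdeal R ^ (n + 1)) a) =
      (maximalIdeal R ^ (n + 2)).submoduleOf (maximalIdeal R ^ (n + 1)) := by
  ext ⟨x, hx⟩
  change _ ↔ x ∈ maximalIdeal R ^ (n + 2)
  rw [maximalIdeal_pow_add_two h, Ideal.mem_span_singleton_mul]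
  constructor
  · rintro ⟨⟨y, hy⟩, hxy⟩
    exact ⟨y, hy, congrArg Subtype.val hxy⟩
  · rintro ⟨y, hy, rfl⟩
    exact ⟨⟨y, hy⟩, rfl⟩

variable [IsNoetherianRing R] {a : R}

/-- R embeds in mⁿ by 1 ↦ aⁿ with cokernel killed by aⁿ, so the length comparison applies. -/
theorem length_maximalIdeal_pow_quotient (ha : a ∈ nonZeroDivisors R) (ham : a ∈ maximalIdeal R)
    (n : ℕ) (hfl : IsFiniteLength R (R ⧸ Ideal.span {a ^ n})) :
    Module.length R (↥(maximalIdeal R ^ n) ⧸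
      LinearMap.range (LinearMap.lsmul R ↥(maximalIdeal R ^ n) a)) =
      Module.length R (R ⧸ Ideal.span {a}) := by
  have han : a ^ n ∈ maximalIdeal R ^ n := Ideal.pow_mem_pow ham n
  let f : R →ₗ[R] ↥(maximalIdeal R ^ n) := LinearMap.toSpanSingleton R _ ⟨a ^ n, han⟩
  symm
  refine length_quotient_span_singleton_eq (f := f) (fun x y hxy => ?_) (fun x y hxy => ?_) ?_
  · exact Subtype.ext ((mul_cancel_left_mem_nonZeroDivisors ha).mp (congrArg Subtype.val hxy))
  · exact (mul_cancel_right_mem_nonZeroDivisors (pow_mem ha n)).mp (congrArg Subtype.val hxy)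
  · exact isFiniteLength_quotient_of_smul_mem hfl fun x =>
      ⟨x, Subtype.ext (mul_comm (x : R) (a ^ n))⟩

variable (ha : a ∈ nonZeroDivisors R) (ham : a ∈ maximalIdeal R)
  (hfl : ∀ s ∈ nonZeroDivisors R, IsFiniteLength R (R ⧸ Ideal.span {s}))
  (h : maximalIdeal R * maximalIdeal R = Ideal.span {a} * maximalIdeal R)

include ha ham hfl h

theorem length_quotient_maximalIdeal_pow {e : ℕ}
    (he : Module.length R (R ⧸ Ideal.span {a}) = e) (n : ℕ) :
    Module.length R (R ⧸ maximalIdeal R ^ (n + 1)) = (n * e + 1 : ℕ) := by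
  induction n with
  | zero => rw [zero_add, pow_one, length_residueField, zero_mul, zero_add, Nat.cast_one]
  | succ n ih =>
    rw [length_quotient_eq_add (Ideal.pow_le_pow_right (Nat.le_succ (n + 1))), ih,
      ← range_lsmul_maximalIdeal_pow h,
      length_maximalIdeal_pow_quotient ha ham _ (hfl _ (pow_mem ha _)), he]
    push_cast
    ring

theorem hasMultiplicity_of_length {e : ℕ} (hdim : ringKrullDim R = 1)
    (he : Module.length R (R ⧸ Ideal.span {a}) = e) : HasMultiplicity R e := by
  refine ⟨1, by rw [hdim]; rfl, ?_⟩
  -- The length formula starts at exponent n + 1; after the shift, (ne + 1)/(n + 1) = e + (1 - e)/(n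
  -- + 1).
  rw [← tendsto_add_atTop_iff_nat 1]
  have h1 : Tendsto (fun n : ℕ => (e : ℝ) + (1 - e) * (1 / ((n : ℝ) + 1))) atTop (𝓝 (e : ℝ)) := by
    simpa using (tendsto_one_div_add_atTop_nhds_zero_nat (𝕜 := ℝ)).const_mul (1 - (e : ℝ))
      |>.const_add (e : ℝ)
  refine h1.congr fun n => ?_
  rw [length_quotient_maximalIdeal_pow ha ham hfl h he, ENat.toNat_natCast]
  have : (n : ℝ) + 1 ≠ 0 := by positivity
  push_cast
  field_simp
  simp
  ring

theorem embeddingDimension_eq_of_length {e : ℕ}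
    (he : Module.length R (R ⧸ Ideal.span {a}) = e) : embeddingDimension R = e := by
  have h1 := length_maximalIdeal_pow_quotient ha ham 1 (hfl _ (pow_mem ha 1))
  have h2 : Module.length R (CotangentSpace R) = e := by
    rw [← he, ← h1, range_lsmul_maximalIdeal_pow h 0]
    -- Generalizing the ideal allows transport along m = m¹, which occurs inside a type.
    have h3 (I : Ideal R) (hI : maximalIdeal R = I) : Module.length R (maximalIdeal R).Cotangent =
        Module.length R (I ⧸ (maximalIdeal R ^ 2).submoduleOf I) := by
      subst hI
      exact length_cotangent _
    exact h3 _ (pow_one _).symm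
  rw [Module.length_eq_of_surjective (R := ResidueField R) residue_surjective,
    Module.length_eq_finrank] at h2
  exact_mod_cast h2

end MinimalMultiplicity

/-! ### The equality C² = B and the bound on ℓ(R/a). -/

section FarFlungGorenstein

variable {R : Type u} [CommRing R] {K : Type v} [CommRing K] [Algebra R K]

theorem div_one_eq (A : Submodule R K) : A / 1 = A :=
  le_antisymm
    (fun x hx => by
      simpa using Submodule.mem_div_iff_forall_mul_mem.mp hx 1 (Submodule.one_le.mp le_rfl))
    (by rw [Submodule.le_div_iff_mul_le, mul_one])

theorem length_integralClosure_quotient_le [IsLocalRing R] {C : Submodule R K}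
    (hC2 : C * C = integralClosureSubmodule R K) {x y : C} (hxy : Submodule.span R {x, y} = ⊤) :
    Module.length R (integralClosureSubmodule R K ⧸
      (maximalIdeal R • ⊤ : Submodule R (integralClosureSubmodule R K))) ≤ 3 := by
  classical
  have hspan : C = Submodule.span R {(x : K), (y : K)} := by
    have := congrArg (Submodule.map C.subtype) hxy
    rw [Submodule.map_span, Submodule.map_subtype_top, Set.image_pair] at this
    exact this.symm
  rw [← hC2]
  let p : (C * C : Submodule R K) := ⟨x * x, Submodule.mul_mem_mul x.2 x.2⟩
  let q : (C * C : Submodule R K) := ⟨x * y, Submodule.mul_mem_mul x.2 y.2⟩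
  let r : (C * C : Submodule R K) := ⟨y * y, Submodule.mul_mem_mul y.2 y.2⟩
  refine (length_quotient_maximalIdeal_smul_le_card {p, q, r} ?_).trans
    (by exact_mod_cast Finset.card_le_three)
  apply Submodule.map_injective_of_injective (C * C).injective_subtype
  rw [Submodule.map_span, Submodule.map_subtype_top]
  refine le_antisymm (Submodule.span_le.mpr ?_) ?_
  · rintro _ ⟨z, -, rfl⟩
    exact z.2
  · refine (congrArg₂ (· * ·) hspan hspan).le.trans ?_
    rw [Submodule.span_mul_span]
    refine Submodule.span_mono ?_
    rintro _ ⟨u, (rfl | rfl), w, (rfl | rfl), rfl⟩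
    · exact ⟨p, by simp, rfl⟩
    · exact ⟨q, by simp, rfl⟩
    · exact ⟨q, by simp, mul_comm _ _⟩
    · exact ⟨r, by simp, rfl⟩

variable [IsFractionRing R K] {ω : Type u} [AddCommGroup ω] [Module R ω]

theorem sq_eq_integralClosureSubmodule
    (hdd : ∀ (C : Submodule R K), Nonempty (C ≃ₗ[R] ω) → C.FG → 1 ≤ C →
      ∀ I : Submodule R K, I.FG → 1 ≤ I → C / (C / I) = I)
    {C : Submodule R K} (e : C ≃ₗ[R] ω) (hC : C.FG) (h1 : 1 ≤ C)
    (hCB : C ≤ integralClosureSubmodule R K) (hB : (integralClosureSubmodule R K).FG)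
    (hffg : IsFarFlungGorenstein R K ω) :
    C / C = 1 ∧ C * C = integralClosureSubmodule R K := by
  have hCC : C / C = 1 := by
    have := hdd C ⟨e⟩ hC h1 1 (Submodule.one_eq_span (R := R) (A := K) ▸
      Submodule.fg_span_singleton 1) le_rfl
    rwa [div_one_eq] at this
  refine ⟨hCC, ?_⟩
  set B := integralClosureSubmodule R K with hBdef
  have hBB : B * B ≤ B := Submodule.mul_le.mpr fun x hx y hy => (integralClosure R K).mul_mem hx hy
  have hB1 : 1 ≤ B := h1.trans hCB
  have hCBB : C * B = B := le_antisymm ((mul_le_mul_left hCB B).trans hBB)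
    (by simpa using mul_le_mul_left h1 B)
  -- The only use of the far-flung condition: R : C ⊆ tr(ω) = R : B.
  have h1C : 1 / C = 1 / B := by
    refine le_antisymm ((one_div_le_map_traceIdeal e h1).trans hffg.le) fun x hx => ?_
    exact Submodule.mem_div_iff_forall_mul_mem.mpr fun y hy =>
      Submodule.mem_div_iff_forall_mul_mem.mp hx y (hCB hy)
  have h2 : C / (C * C) = C / B := by
    rw [← div_div_eq_div_mul, hCC, h1C, ← hCC, div_div_eq_div_mul, hCBB]
  have h1CC : 1 ≤ C * C := by simpa using mul_le_mul' h1 h1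
  rw [← hdd C ⟨e⟩ hC h1 (C * C) (hC.mul hC) h1CC, h2, hdd C ⟨e⟩ hC h1 B hB hB1]

variable [IsLocalRing R]

/-- ℓ(R/a) = ℓ(B/aB) because B/R has finite length, and mB ⊆ aB because each r/a with r ∈ m is
integral. -/
theorem length_quotient_span_singleton_le [IsNoetherianRing R]
    (hfl : ∀ s ∈ nonZeroDivisors R, IsFiniteLength R (R ⧸ Ideal.span {s}))
    (hB : (integralClosureSubmodule R K).FG) {a : R} (ha : a ∈ nonZeroDivisors R)
    (hred : IsReduction (Ideal.span {a}) (maximalIdeal R)) :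
    Module.length R (R ⧸ Ideal.span {a}) ≤
      Module.length R (integralClosureSubmodule R K ⧸
        (maximalIdeal R • ⊤ : Submodule R (integralClosureSubmodule R K))) := by
  have hau : IsUnit (algebraMap R K a) :=
    IsLocalization.map_units K (⟨a, ha⟩ : nonZeroDivisors R)
  let f : R →ₗ[R] integralClosureSubmodule R K := (Algebra.linearMap R K).codRestrict _ fun r =>
    (integralClosure R K).algebraMap_mem r
  have hfin : Module.Finite R (integralClosureSubmodule R K) := Module.Finite.iff_fg.mpr hB
  rw [length_quotient_span_singleton_eq (M := integralClosureSubmodule R K) (a := a) (f := f)]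
  · have hle : (maximalIdeal R • ⊤ : Submodule R (integralClosureSubmodule R K)) ≤
        LinearMap.range (LinearMap.lsmul R (integralClosureSubmodule R K) a) := by
      rw [Submodule.smul_le]
      rintro r hr ⟨y, hy⟩ -
      obtain ⟨z, hz, hza⟩ := exists_isIntegral_of_isReduction hau hred hr
      refine ⟨⟨z * y, (integralClosure R K).mul_mem hz hy⟩, Subtype.ext ?_⟩
      change a • (z * y) = r • y
      rw [Algebra.smul_def, Algebra.smul_def, ← mul_assoc, hza]
    exact Module.length_le_of_surjective (Submodule.factor hle) (Submodule.factor_surjective hle)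
  · intro y z hyz
    have : a • (y : K) = a • (z : K) := congrArg Subtype.val hyz
    rw [Algebra.smul_def, Algebra.smul_def] at this
    exact Subtype.ext (hau.mul_left_cancel this)
  · exact fun y z hyz => IsFractionRing.injective R K (congrArg Subtype.val hyz)
  · obtain ⟨t, ht, htB⟩ := exists_common_denominator hB
    refine isFiniteLength_quotient_of_smul_mem (hfl t ht) fun x => ?_
    obtain ⟨r, hr⟩ := htB x x.2
    exact ⟨r, Subtype.ext (hr.trans (Algebra.smul_def t (x : K)).symm)⟩

end FarFlungGorenstein

/-- A far-flung Gorenstein ring of type two has minimal multiplicity, equal to three. The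
integral closure need not be local. -/
theorem hasMinimalMultiplicity_of_hasType_two (R : Type u) [CommRing R] [IsLocalRing R]
    (hCM : IsCohenMacaulayLocalRing R) (hdim : ringKrullDim R = 1)
    (K : Type v) [CommRing K] [Algebra R K] [IsFractionRing R K]
    (ω : Type u) [AddCommGroup ω] [Module R ω] (hω : IsCanonicalModule R ω)
    (ha : ∃ C : Submodule R K,
      1 ≤ C ∧ C ≤ integralClosureSubmodule R K ∧ Nonempty (C ≃ₗ[R] ω))
    (hb : Module.Finite R (integralClosure R K))
    (hd : ∃ a ∈ maximalIdeal R, a ∈ nonZeroDivisors R ∧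
      IsReduction (Ideal.span {a}) (maximalIdeal R))
    (hffg : IsFarFlungGorenstein R K ω)
    (htype : HasType R R 2) :
    HasMinimalMultiplicity R ∧ HasMultiplicity R 3 := by
  have hN : IsNoetherianRing R := hCM.1
  obtain ⟨a, ham, ha0, hred⟩ := hd
  obtain ⟨C, h1, hCB, ⟨e⟩⟩ := ha
  have hkd : Ring.KrullDimLE 1 R := (Order.krullDimLE_iff 1 _).mpr hdim.le
  have hfl (s : R) (hs : s ∈ nonZeroDivisors R) : IsFiniteLength R (R ⧸ Ideal.span {s}) :=
    isFiniteLength_quotient_span_singleton R hs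
  have hωfin : Module.Finite R ω := hω.maximalCohenMacaulay.1
  have hCfin : Module.Finite R C := Module.Finite.equiv e.symm
  have hCfg : C.FG := Module.Finite.iff_fg.mp hCfin
  have hB : (integralClosureSubmodule R K).FG := Module.Finite.iff_fg.mp hb
  have hd1 {d : ℕ} (h : ringKrullDim R = d) : d = 1 := by
    rw [hdim] at h
    exact_mod_cast h.symm
  have hext2 (M : Type u) [AddCommGroup M] [Module R M] (hM : IsFiniteLength R M) :
      Subsingleton (Abelian.Ext (ModuleCat.of R M) (ModuleCat.of R ω) 2) := by
    obtain ⟨n, hn⟩ := hω.finite_injectiveDimension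
    exact subsingleton_ext_of_hasInjectiveDimensionLE hn ha0 ham (hfl a ha0) 0 hM
  have hext1 : ¬ Subsingleton
      (Abelian.Ext (ModuleCat.of R (ResidueField R)) (ModuleCat.of R ω) 1) := by
    obtain ⟨d, hd, hlen⟩ := hω.type_one
    obtain rfl := hd1 hd
    rw [← Module.length_eq_zero_iff (R := R), hlen]
    decide
  have hsep (I J : Ideal R) (hIJ : I ≤ J) (hI : IsFiniteLength R (R ⧸ I))
      (h : ∀ f : I →ₗ[R] ω, ∃ g : J →ₗ[R] ω, g ∘ₗ Submodule.inclusion hIJ = f) : I = J :=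
    ideal_eq_of_extends hext2 hext1 hIJ hI h
  obtain ⟨hCC, hC2⟩ := sq_eq_integralClosureSubmodule (ω := ω)
    (fun C ⟨e⟩ hC h1 I hI h1I => div_div_eq_self hsep hfl e hC h1 hI (one_mem _)
      (by simpa using Submodule.one_le.mp h1I)) e hCfg h1 hCB hB hffg
  have hsoc : Module.length R (socle R (R ⧸ Ideal.span {a})) = 2 := by
    obtain ⟨d, hd, hlen⟩ := htype
    obtain rfl := hd1 hd
    rw [← length_ext_one_residueField ha0 ham, hlen]
    rfl
  have hCN : IsNoetherian R C := isNoetherian_of_isNoetherianRing_of_finite R C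
  obtain ⟨x, y, hxy⟩ := exists_span_pair_eq_top (hsoc ▸
    length_quotient_maximalIdeal_smul_le h1 hCC ha0 ham fun I hI haI =>
      div_div_eq_self hsep hfl e hCfg h1 (isNoetherian_submodule.mp hCN I hI) ha0 haI)
  obtain ⟨hlen, hmm⟩ := length_quotient_eq_three_of_socle ham
    ((length_quotient_span_singleton_le hfl hB ha0 hred).trans
      (length_integralClosure_quotient_le hC2 hxy)) hsoc
  have hm := maximalIdeal_mul_self_eq ha0 hred hmm
  have hmult := hasMultiplicity_of_length ha0 ham hfl hm hdim (e := 3) hlen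
  exact ⟨⟨3, 1, hdim, hmult, by rw [embeddingDimension_eq_of_length ha0 ham hfl hm hlen]⟩, hmult⟩

end FarFlung

theorem mainTheorem11 (R : Type u) [CommRing R] [IsLocalRing R]
    (hCM : FarFlung.IsCohenMacaulayLocalRing R) (hdim : ringKrullDim R = 1)
    (K : Type v) [CommRing K] [Algebra R K] [IsFractionRing R K]
    (ω : Type u) [AddCommGroup ω] [Module R ω] (hω : FarFlung.IsCanonicalModule R ω)
    (ha : ∃ C : Submodule R K,
      1 ≤ C ∧ C ≤ FarFlung.integralClosureSubmodule R K ∧ Nonempty (C ≃ₗ[R] ω))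
    (hb : Module.Finite R (integralClosure R K))
    (hc : IsLocalRing (integralClosure R K))
    (hd : ∃ a ∈ IsLocalRing.maximalIdeal R, a ∈ nonZeroDivisors R ∧
      FarFlung.IsReduction (Ideal.span {a}) (IsLocalRing.maximalIdeal R))
    (hffg : FarFlung.IsFarFlungGorenstein R K ω)
    (htype : FarFlung.HasType R R 2) :
    FarFlung.HasMinimalMultiplicity R ∧ FarFlung.HasMultiplicity R 3 := by
  exact FarFlung.hasMinimalMultiplicity_of_hasType_two R hCM hdim K ω hω ha hb hd hffg htype
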